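/- **Setting.** A slate has $K$ slots, with actions $[d_k]=\{1,\dots,d_k\}$ in slot $k$. Let $X\sim\nu$ be a context in a measurable space, let the slate $A=(A_1,\dots,A_K)$ be drawn given $X$ from a factored logging policy $\mu(a\mid x)=\prod_{k}\mu_k(a_k\mid x)$, and let the reward $R\in\mathbb R$ be drawn from a conditional law given $(X,A)$. Let $\pi(\cdot\mid x)$ be a target policy on slates, write $\pi(a_k\mid x)$ for its slot-$k$ marginal, and assume that for $\nu$-almost every $x$, $\mu_k(a_k\mid x)=0$ implies $\pi(a_k\mid x)=0$ for all $k$ and $a_k$. Put $$Y_k=\frac{\pi(A_k\mid X)}{\mu_k(A_k\mid X)},\qquad G=1+\sum_{k=1}^K(Y_k-1),\qquad \theta=\mathbb E[GR],$$ $$V^*=\inf_{w\in\mathbb R^K}\operatorname{Var}\Big(GR-\sum_{k=1}^K w_k(Y_k-1)\Big),$$ and assume $\mathbb E[(GR)^2]<\infty$ and $\mathbb E[Y_k^2]<\infty$ for all $k$. **Estimator.** Let $(X_i,A_i,R_i)$, $i\ge1$, be i.i.d. copies of $(X,A,R)$. For each $n$, split $\{1,\dots,n\}$ at random, independently of the first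 $n$ observations, into three folds $\mathcal D_0,\mathcal D_1,\mathcal D_2$, each of size $\lfloor n/3\rfloor$ or $\lceil n/3\rceil$ (the law of the split is otherwise arbitrary). Let $\mathbb E_n$ and $\mathbb E_{\mathcal D_j}$ denote sample averages over all $n$ observations and over $\mathcal D_j$ (an average over the empty set is $0$), and, with the convention $0/0=0$, let $$\hat w^{(j)}_{n,k}=\frac{\mathbb E_{\mathcal D_j}[GR(Y_k-1)]}{\mathbb E_{\mathcal D_j}[(Y_k-1)^2]},\qquad \hat\theta^*_n=\mathbb E_n[GR]-\sum_{k=1}^K\sum_{j=0}^{2}\frac{|\mathcal D_j|}{n}\,\hat w^{(j+1\bmod 3)}_{n,k}\,\mathbb E_{\mathcal D_j}[Y_k-1].$$ **Lemma 11.** 1. (Unbiasedness.) For every $n\ge1$ for which $\hat\theta^*_n$ is integrable, $\mathbb E[\hat\theta^*_n]=\theta$. Here $\hat\theta^*_n$ is integrable whenever all the weights $\hat w^{(j)}_{n,k}$ are integrable, and the weights are integrable for every $n$ if $\mathbb E\big[\tfrac{|GR|}{|Y_k-1|}\mathbf 1\{Y_k\ne1\}\big]<\infty$ for all $k$. 2.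 (Asymptotic normality.) As $n\to\infty$, $\sqrt n(\hat\theta^*_n-\theta)\to_d\mathcal N(0,V^*)$, where $\mathcal N(0,0)$ is the point mass at $0$. -/

import Mathlib

open MeasureTheory ProbabilityTheory Filter
open scoped ENNReal NNReal

namespace SlateOPE

/-- A slate picks, for every slot `k`, one of the `d k` actions of that slot. -/
abbrev Slate {K : ℕ} (d : Fin K → ℕ) : Type := ∀ k : Fin K, Fin (d k)

/-- A logged observation `((x, a), r)`: context, slate, reward. -/
abbrev Obs {K : ℕ} (𝒳 : Type*) (d : Fin K → ℕ) : Type _ := (𝒳 × Slate d) × ℝ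

section Population

variable {K : ℕ} {d : Fin K → ℕ} {𝒳 : Type*} [MeasurableSpace 𝒳]

theorem measurable_pi_slot (μ : ∀ k, Kernel 𝒳 (Fin (d k))) [∀ k, IsMarkovKernel (μ k)] :
    Measurable (fun x => Measure.pi (fun k => μ k x) : 𝒳 → Measure (Slate d)) := by
  refine Measure.measurable_of_measurable_coe _ fun s _ => ?_
  have h : ∀ x, Measure.pi (fun k => μ k x) s
      = ∑ a ∈ s.toFinite.toFinset, ∏ k, μ k x {a k} := by
    intro x
    rw [← s.toFinite.coe_toFinset, ← sum_measure_singleton]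
    simp
  simp_rw [h]
  exact Finset.measurable_sum _ fun a _ => Finset.measurable_prod _ fun k _ =>
    (μ k).measurable_coe (measurableSet_singleton _)

/-- The factored policy `μ(a ∣ x) = ∏ k, μ k (a k ∣ x)`. -/
noncomputable def factored (μ : ∀ k, Kernel 𝒳 (Fin (d k))) [∀ k, IsMarkovKernel (μ k)] :
    Kernel 𝒳 (Slate d) where
  toFun x := Measure.pi fun k => μ k x
  measurable' := measurable_pi_slot μ

instance (μ : ∀ k, Kernel 𝒳 (Fin (d k))) [∀ k, IsMarkovKernel (μ k)] :
    IsMarkovKernel (factored μ) :=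
  ⟨fun x => inferInstanceAs (IsProbabilityMeasure (Measure.pi fun k => μ k x))⟩

/-- The law of `(X, A, R)` with `X ∼ ν`, `A ∼ μ(· ∣ X)` for the factored policy `μ`, and
`R ∼ ρ(· ∣ X, A)`. -/
noncomputable def dataLaw (ν : Measure 𝒳) (μ : ∀ k, Kernel 𝒳 (Fin (d k)))
    [∀ k, IsMarkovKernel (μ k)] (ρ : Kernel (𝒳 × Slate d) ℝ) : Measure (Obs 𝒳 d) :=
  (ν ⊗ₘ factored μ) ⊗ₘ ρ

/-- The marginal probability `π(a ∣ x)` that the slate policy `π` puts action `a` in slot `k`. -/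
noncomputable def slotProb (π : Kernel 𝒳 (Slate d)) (k : Fin K) (x : 𝒳) (a : Fin (d k)) : ℝ :=
  (π x).real {b | b k = a}

variable (μ : ∀ k, Kernel 𝒳 (Fin (d k))) (π : Kernel 𝒳 (Slate d))

/-- The slot-level density ratio `Y_k = π(A_k ∣ X) / μ_k(A_k ∣ X)`. -/
noncomputable def Y (k : Fin K) (o : Obs 𝒳 d) : ℝ :=
  slotProb π k o.1.1 (o.1.2 k) / (μ k o.1.1).real {o.1.2 k}

/-- `G = 1 + ∑ k, (Y_k - 1)`. -/
noncomputable def G (o : Obs 𝒳 d) : ℝ := 1 + ∑ k, (Y μ π k o - 1)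

/-- The product `G R`. -/
noncomputable def GR (o : Obs 𝒳 d) : ℝ := G μ π o * o.2

/-- `Γ_w = G R - ∑ k, w_k (Y_k - 1)`. -/
noncomputable def Gam (w : Fin K → ℝ) (o : Obs 𝒳 d) : ℝ :=
  GR μ π o - ∑ k, w k * (Y μ π k o - 1)

/-- The estimand `θ = E[G R]`. -/
noncomputable def theta (L : Measure (Obs 𝒳 d)) : ℝ := ∫ o, GR μ π o ∂L

/-- The optimal variance `V* = inf_w Var(Γ_w)`, the infimum being over all `w ∈ ℝ^K`. -/
noncomputable def Vstar (L : Measure (Obs 𝒳 d)) : ℝ := ⨅ w : Fin K → ℝ, Var[Gam μ π w; L]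

end Population

section Estimator

variable {K : ℕ} {d : Fin K → ℕ} {𝒳 : Type*} [MeasurableSpace 𝒳] {n : ℕ}

/-- The `j`-th fold of the split `s`. -/
def fold (s : Fin n → Fin 3) (j : Fin 3) : Finset (Fin n) := {i | s i = j}

/-- The three folds are even: each has size `⌊n/3⌋` or `⌈n/3⌉`. -/
def IsEvenSplit (s : Fin n → Fin 3) : Prop :=
  ∀ j, n / 3 ≤ (fold s j).card ∧ (fold s j).card ≤ (n + 2) / 3

/-- The average of `f` over the data points with index in `D` (equal to `0` if `D` is empty). -/
noncomputable def avg (D : Finset (Fin n)) (data : Fin n → Obs 𝒳 d) (f : Obs 𝒳 d → ℝ) : ℝ :=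
  (D.card : ℝ)⁻¹ * ∑ i ∈ D, f (data i)

variable (μ : ∀ k, Kernel 𝒳 (Fin (d k))) (π : Kernel 𝒳 (Slate d))

/-- The weight of control variate `k` fitted on fold `j`. If its denominator vanishes then so does
its numerator, and the weight is `0`. -/
noncomputable def weight (s : Fin n → Fin 3) (data : Fin n → Obs 𝒳 d) (j : Fin 3) (k : Fin K) : ℝ :=
  avg (fold s j) data (fun o => GR μ π o * (Y μ π k o - 1)) /
    avg (fold s j) data (fun o => (Y μ π k o - 1) ^ 2)

/-- The cross-fitted estimator; the sum `j + 1` in `Fin 3` is taken modulo 3. -/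
noncomputable def thetaHat (s : Fin n → Fin 3) (data : Fin n → Obs 𝒳 d) : ℝ :=
  avg Finset.univ data (GR μ π) -
    ∑ k, ∑ j : Fin 3, ((fold s j).card : ℝ) / n * weight μ π s data (j + 1) k *
      avg (fold s j) data (fun o => Y μ π k o - 1)

end Estimator

end SlateOPE

/-! Conditionally on the split, which is independent of the data, the folds carry independent
samples, and every claim reduces to a fixed split followed by integration over its finitely many
values.

Unbiasedness. The estimator is the sample mean of `GR` minus the correction `w₁ ⬝ z₀ + w₂ ⬝ z₁ + w₀
⬝ z₂`, where `w_j` and `z_j` are the weights and centred means of fold `j`. Coverage gives `E[Y_k -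
1] = 0`, so each product pairs a centred vector with an independent weight. The difficulty is that
only the whole estimator is assumed integrable, not each product: the cycle of dependences is opened
in `integral_cyclic_dotProduct_eq_zero`.

Asymptotic normality. Given the context, the control variates are independent across slots and
centred, hence pairwise uncorrelated. The joint least-squares problem therefore splits into `K`
univariate ones, and `V*` is attained at the quotients `wStar` (`Vstar_eq_variance`). By
`sqrt_mul_thetaHat_sub`, the scaled estimation error differs from the normalised sum of `Γ_{w*}` by
terms (weight error) × (`√n` fold mean). The first factor tends to `0` by a law of large numbers on
the folds and the second is bounded in probability by Chebyshev
(`tendstoInMeasure_weight_error_mul`); the central limit theorem and Slutsky's lemma conclude. -/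

namespace SlateOPE

/-! ### Population moments of the control variates and the optimal variance. -/

section PopulationFacts

variable {K : ℕ} {d : Fin K → ℕ} {𝒳 : Type*} [MeasurableSpace 𝒳]

@[fun_prop]
theorem measurable_Y (μ : ∀ k, Kernel 𝒳 (Fin (d k))) (π : Kernel 𝒳 (Slate d)) (k : Fin K) :
    Measurable (Y μ π k) := by
  have h : Measurable (fun p : 𝒳 × Slate d =>
      slotProb π k p.1 (p.2 k) / (μ k p.1).real {p.2 k}) := by
    refine measurable_from_prod_countable_left fun a => ?_
    refine Measurable.div ?_ ?_
    · exact (π.measurable_coe (Set.toFinite {b : Slate d | b k = a k}).measurableSet).ennreal_toReal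
    · exact ((μ k).measurable_coe (measurableSet_singleton _)).ennreal_toReal
  exact h.comp measurable_fst

@[fun_prop]
theorem measurable_GR (μ : ∀ k, Kernel 𝒳 (Fin (d k))) (π : Kernel 𝒳 (Slate d)) :
    Measurable (GR μ π) := by
  unfold GR G
  fun_prop

@[fun_prop]
theorem measurable_Gam (μ : ∀ k, Kernel 𝒳 (Fin (d k))) (π : Kernel 𝒳 (Slate d))
    (w : Fin K → ℝ) : Measurable (Gam μ π w) := by
  unfold Gam
  fun_prop

instance (ν : Measure 𝒳) [IsProbabilityMeasure ν] (μ : ∀ k, Kernel 𝒳 (Fin (d k)))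
    [∀ k, IsMarkovKernel (μ k)] (ρ : Kernel (𝒳 × Slate d) ℝ) [IsMarkovKernel ρ] :
    IsProbabilityMeasure (dataLaw ν μ ρ) := by
  unfold dataLaw
  infer_instance

theorem sum_slotProb (π : Kernel 𝒳 (Slate d)) [IsMarkovKernel π] (k : Fin K) (x : 𝒳) :
    ∑ a, slotProb π k x a = 1 := by
  have : IsProbabilityMeasure ((π x).map (fun b => b k)) :=
    Measure.isProbabilityMeasure_map (measurable_pi_apply k).aemeasurable
  have h : ∀ a, slotProb π k x a = ((π x).map (fun b => b k)).real {a} := by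
    intro a
    rw [map_measureReal_apply (measurable_pi_apply k) (measurableSet_singleton _)]
    rfl
  simp_rw [h]
  rw [sum_measureReal_singleton]
  simp

/-- Weighting by `μ_k` turns the ratio back into `π`, so the integral is `∑ π - ∑ μ_k = 1 - 1`.
Coverage is what keeps mass of `π` from being lost at actions where `μ_k` vanishes. -/
theorem integral_ratio_sub_one (μ : ∀ k, Kernel 𝒳 (Fin (d k))) [∀ k, IsMarkovKernel (μ k)]
    (π : Kernel 𝒳 (Slate d)) [IsMarkovKernel π] (k : Fin K) {x : 𝒳}
    (hx : ∀ a, μ k x {a} = 0 → slotProb π k x a = 0) :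
    ∫ a : Slate d, (slotProb π k x (a k) / (μ k x).real {a k} - 1) ∂(factored μ x) = 0 := by
  have hmp : MeasurePreserving (fun a : Slate d => a k) (factored μ x) (μ k x) :=
    measurePreserving_eval (fun k => μ k x) k
  have hmap := integral_map (μ := factored μ x) (f := fun c => slotProb π k x c / (μ k x).real {c} - 1)
    hmp.measurable.aemeasurable (measurable_of_countable _).aestronglyMeasurable
  rw [hmp.map_eq] at hmap
  rw [← hmap, integral_fintype .of_finite]
  have h : ∀ c, (μ k x).real {c} • (slotProb π k x c / (μ k x).real {c} - 1)
      = slotProb π k x c - (μ k x).real {c} := by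
    intro c
    by_cases hc : (μ k x).real {c} = 0
    · rw [hc, hx c ((measureReal_eq_zero_iff).1 hc)]; simp
    · rw [smul_eq_mul]; field_simp
  simp_rw [h]
  rw [Finset.sum_sub_distrib, sum_slotProb, sum_measureReal_singleton]
  simp

/-- The control variates do not involve the reward, so their moments can be computed by conditioning
on the context alone. -/
theorem integral_dataLaw_fst (ν : Measure 𝒳) [IsProbabilityMeasure ν]
    (μ : ∀ k, Kernel 𝒳 (Fin (d k))) [∀ k, IsMarkovKernel (μ k)]
    (ρ : Kernel (𝒳 × Slate d) ℝ) [IsMarkovKernel ρ] {f : 𝒳 × Slate d → ℝ} (hf : Measurable f)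
    (hint : Integrable (fun o : Obs 𝒳 d => f o.1) (dataLaw ν μ ρ)) :
    ∫ o, f o.1 ∂(dataLaw ν μ ρ) = ∫ x, ∫ a, f (x, a) ∂(factored μ x) ∂ν := by
  have hfst : (dataLaw ν μ ρ).map Prod.fst = ν ⊗ₘ factored μ :=
    Measure.fst_compProd (ν ⊗ₘ factored μ) ρ
  rw [← integral_map (f := f) (by fun_prop) hf.aestronglyMeasurable, hfst,
    Measure.integral_compProd]
  rw [← hfst]
  exact (integrable_map_measure hf.aestronglyMeasurable (by fun_prop)).2 hint

theorem memLp_Gam {ν : Measure 𝒳} [IsProbabilityMeasure ν]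
    {μ : ∀ k, Kernel 𝒳 (Fin (d k))} [∀ k, IsMarkovKernel (μ k)]
    {ρ : Kernel (𝒳 × Slate d) ℝ} [IsMarkovKernel ρ] {π : Kernel 𝒳 (Slate d)}
    (hGR : MemLp (GR μ π) 2 (dataLaw ν μ ρ))
    (hY : ∀ k, MemLp (Y μ π k) 2 (dataLaw ν μ ρ)) (w : Fin K → ℝ) :
    MemLp (Gam μ π w) 2 (dataLaw ν μ ρ) :=
  hGR.sub (memLp_finsetSum _ fun k _ => ((hY k).sub (memLp_const 1)).const_mul (w k))

variable (ν : Measure 𝒳) [IsProbabilityMeasure ν]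
    (μ : ∀ k, Kernel 𝒳 (Fin (d k))) [∀ k, IsMarkovKernel (μ k)]
    (ρ : Kernel (𝒳 × Slate d) ℝ) [IsMarkovKernel ρ]
    (π : Kernel 𝒳 (Slate d)) [IsMarkovKernel π]

theorem measurable_ratio_sub_one (μ : ∀ k, Kernel 𝒳 (Fin (d k))) (π : Kernel 𝒳 (Slate d))
    (k : Fin K) : Measurable (fun p : 𝒳 × Slate d =>
      slotProb π k p.1 (p.2 k) / (μ k p.1).real {p.2 k} - 1) :=
  ((measurable_Y μ π k).comp (measurable_id.prodMk measurable_const :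
    Measurable fun p : 𝒳 × Slate d => (p, (0 : ℝ)))).sub_const 1

theorem integral_Y_sub_one
    (hcover : ∀ᵐ x ∂ν, ∀ k a, μ k x {a} = 0 → slotProb π k x a = 0) (k : Fin K)
    (hY : MemLp (Y μ π k) 2 (dataLaw ν μ ρ)) :
    ∫ o, (Y μ π k o - 1) ∂(dataLaw ν μ ρ) = 0 := by
  have hint : Integrable (fun o => Y μ π k o - 1) (dataLaw ν μ ρ) :=
    (hY.integrable one_le_two).sub (integrable_const 1)
  have := integral_dataLaw_fst ν μ ρ (measurable_ratio_sub_one μ π k) hint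
  refine this.trans ?_
  rw [integral_congr_ae (g := fun _ => (0 : ℝ)), integral_zero]
  filter_upwards [hcover] with x hx
  exact integral_ratio_sub_one μ π k (hx k)

/-- At a fixed context the factored policy is a product measure, so distinct slots are independent
and the conditional mean of the product factors into zeros. -/
theorem integral_Y_sub_one_mul_Y_sub_one
    (hcover : ∀ᵐ x ∂ν, ∀ k a, μ k x {a} = 0 → slotProb π k x a = 0) {k l : Fin K} (hkl : k ≠ l)
    (hYk : MemLp (Y μ π k) 2 (dataLaw ν μ ρ)) (hYl : MemLp (Y μ π l) 2 (dataLaw ν μ ρ)) :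
    ∫ o, (Y μ π k o - 1) * (Y μ π l o - 1) ∂(dataLaw ν μ ρ) = 0 := by
  have hint : Integrable (fun o => (Y μ π k o - 1) * (Y μ π l o - 1)) (dataLaw ν μ ρ) :=
    (hYk.sub (memLp_const 1)).integrable_mul (hYl.sub (memLp_const 1))
  have := integral_dataLaw_fst ν μ ρ
    ((measurable_ratio_sub_one μ π k).mul (measurable_ratio_sub_one μ π l)) hint
  refine this.trans ?_
  rw [integral_congr_ae (g := fun _ => (0 : ℝ)), integral_zero]
  filter_upwards [hcover] with x hx
  have hind : IndepFun
      (fun a : Slate d => slotProb π k x (a k) / (μ k x).real {a k} - 1)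
      (fun a : Slate d => slotProb π l x (a l) / (μ l x).real {a l} - 1) (factored μ x) :=
    (iIndepFun_pi (μ := fun k => μ k x)
      (X := fun k c => slotProb π k x c / (μ k x).real {c} - 1)
      fun i => (measurable_of_countable _).aemeasurable).indepFun hkl
  refine (hind.integral_fun_mul_eq_mul_integral ?_ ?_).trans ?_
  · exact (measurable_of_countable _).aestronglyMeasurable
  · exact (measurable_of_countable _).aestronglyMeasurable
  · rw [integral_ratio_sub_one μ π k (hx k), zero_mul]

/-- The population regression coefficients of `G R` on the control variates `Y_k - 1`. -/
noncomputable def wStar (μ : ∀ k, Kernel 𝒳 (Fin (d k))) (π : Kernel 𝒳 (Slate d))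
    (L : Measure (Obs 𝒳 d)) (k : Fin K) : ℝ :=
  (∫ o, GR μ π o * (Y μ π k o - 1) ∂L) / ∫ o, (Y μ π k o - 1) ^ 2 ∂L

variable {ν μ ρ π}

theorem integral_Gam
    (hcover : ∀ᵐ x ∂ν, ∀ k a, μ k x {a} = 0 → slotProb π k x a = 0)
    (hGR : MemLp (GR μ π) 2 (dataLaw ν μ ρ))
    (hY : ∀ k, MemLp (Y μ π k) 2 (dataLaw ν μ ρ)) (w : Fin K → ℝ) :
    ∫ o, Gam μ π w o ∂(dataLaw ν μ ρ) = theta μ π (dataLaw ν μ ρ) := by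
  have hZ : ∀ k, Integrable (fun o => w k * (Y μ π k o - 1)) (dataLaw ν μ ρ) := fun k =>
    (((hY k).integrable one_le_two).sub (integrable_const 1)).const_mul _
  unfold Gam theta
  rw [integral_sub (hGR.integrable one_le_two) (integrable_finsetSum _ fun k _ => hZ k),
    integral_finsetSum _ fun k _ => hZ k]
  simp_rw [integral_const_mul, integral_Y_sub_one ν μ ρ π hcover _ (hY _)]
  simp

/-- These are the normal equations of the joint regression. Since the Gram matrix of the control
variates is diagonal, the univariate quotients solve them. -/
theorem integral_Gam_wStar_mul
    (hcover : ∀ᵐ x ∂ν, ∀ k a, μ k x {a} = 0 → slotProb π k x a = 0)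
    (hGR : MemLp (GR μ π) 2 (dataLaw ν μ ρ))
    (hY : ∀ k, MemLp (Y μ π k) 2 (dataLaw ν μ ρ)) (l : Fin K) :
    ∫ o, Gam μ π (wStar μ π (dataLaw ν μ ρ)) o * (Y μ π l o - 1) ∂(dataLaw ν μ ρ) = 0 := by
  set L := dataLaw ν μ ρ
  have hZ : ∀ k, MemLp (fun o => Y μ π k o - 1) 2 L := fun k => (hY k).sub (memLp_const 1)
  have hZZ : ∀ k, Integrable (fun o => wStar μ π L k *
      ((Y μ π k o - 1) * (Y μ π l o - 1))) L := fun k =>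
    ((hZ k).integrable_mul (hZ l)).const_mul _
  have hexp : ∀ o, Gam μ π (wStar μ π L) o * (Y μ π l o - 1)
      = GR μ π o * (Y μ π l o - 1)
        - ∑ k, wStar μ π L k * ((Y μ π k o - 1) * (Y μ π l o - 1)) := by
    intro o
    simp only [Gam, sub_mul, Finset.sum_mul, mul_assoc]
  simp_rw [hexp]
  have hGZ : Integrable (fun o => GR μ π o * (Y μ π l o - 1)) L := hGR.integrable_mul (hZ l)
  rw [integral_sub hGZ (integrable_finsetSum _ fun k _ => hZZ k),
    integral_finsetSum _ fun k _ => hZZ k, Finset.sum_eq_single l]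
  · rw [integral_const_mul]
    simp_rw [← pow_two]
    unfold wStar
    by_cases h0 : ∫ o, (Y μ π l o - 1) ^ 2 ∂L = 0
    -- Degenerate slot: `Y_l = 1` almost surely, so the cross moment with `GR` vanishes too and the
    -- value of the quotient is irrelevant.
    · rw [h0, mul_zero, sub_zero]
      have hae := (integral_eq_zero_iff_of_nonneg (fun o => sq_nonneg (Y μ π l o - 1))
        (hZ l).integrable_sq).1 h0
      rw [integral_congr_ae (g := fun _ => (0 : ℝ)), integral_zero]
      filter_upwards [hae] with o ho
      have : Y μ π l o - 1 = 0 := by simpa using ho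
      simp [this]
    · rw [div_mul_cancel₀ _ h0, sub_self]
  · intro k _ hk
    rw [integral_const_mul, integral_Y_sub_one_mul_Y_sub_one ν μ ρ π hcover hk (hY k) (hY l),
      mul_zero]
  · simp

/-- Pythagoras: `Γ_w` is `Γ_{w*}` minus a combination of control variates uncorrelated with it, so
its variance can only be larger. -/
theorem Vstar_eq_variance
    (hcover : ∀ᵐ x ∂ν, ∀ k a, μ k x {a} = 0 → slotProb π k x a = 0)
    (hGR : MemLp (GR μ π) 2 (dataLaw ν μ ρ))
    (hY : ∀ k, MemLp (Y μ π k) 2 (dataLaw ν μ ρ)) :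
    Vstar μ π (dataLaw ν μ ρ)
      = Var[Gam μ π (wStar μ π (dataLaw ν μ ρ)); dataLaw ν μ ρ] := by
  set L := dataLaw ν μ ρ
  have hZ : ∀ k, MemLp (fun o => Y μ π k o - 1) 2 L := fun k => (hY k).sub (memLp_const 1)
  refine le_antisymm (ciInf_le ⟨0, ?_⟩ _) (le_ciInf fun w => ?_)
  · rintro _ ⟨w, rfl⟩
    exact variance_nonneg _ _
  set v : Fin K → ℝ := fun k => w k - wStar μ π L k
  have hG := memLp_Gam hGR hY (wStar μ π L)
  have hS : ∀ k, MemLp (fun o => v k * (Y μ π k o - 1)) 2 L := fun k => (hZ k).const_mul _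
  have hw : Gam μ π w = fun o => Gam μ π (wStar μ π L) o - ∑ k, v k * (Y μ π k o - 1) := by
    funext o
    simp only [Gam, v, sub_mul, Finset.sum_sub_distrib]
    ring
  have hcov : cov[Gam μ π (wStar μ π L), fun o => ∑ k, v k * (Y μ π k o - 1); L] = 0 := by
    rw [covariance_fun_sum_right hS hG]
    refine Finset.sum_eq_zero fun k _ => ?_
    rw [covariance_const_mul_right, covariance_eq_sub hG (hZ k),
      integral_Y_sub_one ν μ ρ π hcover k (hY k)]
    have := integral_Gam_wStar_mul hcover hGR hY k
    simp only [Pi.mul_apply]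
    rw [this]
    simp
  rw [hw, variance_fun_sub hG (memLp_finsetSum _ fun k _ => hS k), hcov]
  linarith [variance_nonneg (fun o => ∑ k, v k * (Y μ π k o - 1)) L]

end PopulationFacts

/-! ### Mean zero of a cyclic sum of products of independent vectors. -/

section CyclicProduct

variable {K : ℕ}

/-- Three independent pairs `(w_j, z_j)` of random vectors, each `z_j` centred. If
`w₁ ⬝ z₀ + w₂ ⬝ z₁ + w₀ ⬝ z₂` is integrable then it is centred, even if the three products are not
integrable separately. -/
theorem integral_cyclic_dotProduct_eq_zero
    (ρ₀ ρ₁ ρ₂ : Measure ((Fin K → ℝ) × (Fin K → ℝ)))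
    [IsProbabilityMeasure ρ₀] [IsProbabilityMeasure ρ₁] [IsProbabilityMeasure ρ₂]
    (hi₀ : Integrable (fun u => u.2) ρ₀) (hi₁ : Integrable (fun u => u.2) ρ₁)
    (hi₂ : Integrable (fun u => u.2) ρ₂)
    (hz₀ : ∫ u, u.2 ∂ρ₀ = 0) (hz₁ : ∫ u, u.2 ∂ρ₁ = 0) (hz₂ : ∫ u, u.2 ∂ρ₂ = 0)
    (hT : Integrable (fun p : ((Fin K → ℝ) × (Fin K → ℝ)) ×
        (((Fin K → ℝ) × (Fin K → ℝ)) × ((Fin K → ℝ) × (Fin K → ℝ))) =>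
      p.2.1.1 ⬝ᵥ p.1.2 + p.2.2.1 ⬝ᵥ p.2.1.2 + p.1.1 ⬝ᵥ p.2.2.2) (ρ₀.prod (ρ₁.prod ρ₂))) :
    ∫ p, (p.2.1.1 ⬝ᵥ p.1.2 + p.2.2.1 ⬝ᵥ p.2.1.2 + p.1.1 ⬝ᵥ p.2.2.2)
      ∂(ρ₀.prod (ρ₁.prod ρ₂)) = 0 := by
  have hdot : ∀ (ρ : Measure ((Fin K → ℝ) × (Fin K → ℝ))) (w : Fin K → ℝ),
      Integrable (fun u => u.2) ρ → ∫ u, u.2 ∂ρ = 0 →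
      Integrable (fun u => w ⬝ᵥ u.2) ρ ∧ ∫ u, w ⬝ᵥ u.2 ∂ρ = 0 := by
    intro ρ w hi hz
    let ℓ : (Fin K → ℝ) →L[ℝ] ℝ := LinearMap.toContinuousLinearMap (dotProductBilin ℝ ℝ w)
    refine ⟨ℓ.integrable_comp hi, ?_⟩
    have := ℓ.integral_comp_comm hi
    rw [hz, map_zero] at this
    exact this
  -- Since `w₀` need not be integrable, `z ↦ E[w₀ ⬝ z]` is only defined on this subspace. It is
  -- linear there, and extends to a functional `g` on the whole space.
  let S : Submodule ℝ (Fin K → ℝ) :=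
    { carrier := {z | Integrable (fun u : (Fin K → ℝ) × (Fin K → ℝ) => u.1 ⬝ᵥ z) ρ₀}
      add_mem' := fun {a b} ha hb => by
        simp only [Set.mem_ofPred_eq, dotProduct_add]
        exact Integrable.add ha hb
      zero_mem' := by simp
      smul_mem' := fun c z hz => by
        simp only [Set.mem_ofPred_eq, dotProduct_smul]
        exact Integrable.smul c hz }
  let h : S →ₗ[ℝ] ℝ :=
    { toFun := fun z => ∫ u, u.1 ⬝ᵥ (z : Fin K → ℝ) ∂ρ₀
      map_add' := fun a b => by
        simp only [Submodule.coe_add, dotProduct_add]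
        exact integral_add a.2 b.2
      map_smul' := fun c z => by
        simp only [Submodule.coe_smul, dotProduct_smul, RingHom.id_apply]
        exact integral_smul c _ }
  obtain ⟨g, hg⟩ := h.exists_extend
  have hgS : ∀ z ∈ S, ∫ u, u.1 ⬝ᵥ z ∂ρ₀ = g z := fun z hz =>
    (LinearMap.congr_fun hg ⟨z, hz⟩).symm
  have hfix : ∀ᵐ q ∂(ρ₁.prod ρ₂), q.2.2 ∈ S ∧
      ∫ u, (q.1.1 ⬝ᵥ u.2 + q.2.1 ⬝ᵥ q.1.2 + u.1 ⬝ᵥ q.2.2) ∂ρ₀ = q.2.1 ⬝ᵥ q.1.2 + g q.2.2 := by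
    filter_upwards [hT.prod_left_ae] with q hq
    obtain ⟨h1, h2⟩ := hdot ρ₀ q.1.1 hi₀ hz₀
    have h3 : Integrable (fun u : (Fin K → ℝ) × (Fin K → ℝ) =>
        q.1.1 ⬝ᵥ u.2 + q.2.1 ⬝ᵥ q.1.2) ρ₀ := h1.add (integrable_const _)
    -- With folds 1 and 2 frozen, `w₁ ⬝ z₀` is integrable and `w₂ ⬝ z₁` is constant, so
    -- integrability of the total forces that of `w₀ ⬝ z₂`.
    have hS : q.2.2 ∈ S := by
      refine (hq.sub h3).congr (ae_of_all _ fun u => ?_)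
      simp
    refine ⟨hS, ?_⟩
    rw [integral_add h3 hS, integral_add h1 (integrable_const _), h2, hgS _ hS]
    simp
  have hF := hT.integral_prod_right
  have hF' : Integrable (fun q : ((Fin K → ℝ) × (Fin K → ℝ)) × ((Fin K → ℝ) × (Fin K → ℝ)) =>
      q.2.1 ⬝ᵥ q.1.2 + g q.2.2) (ρ₁.prod ρ₂) :=
    hF.congr (hfix.mono fun q hq => hq.2)
  rw [integral_prod_symm _ hT, integral_congr_ae (hfix.mono fun q hq => hq.2),
    integral_prod_symm _ hF']
  -- Averaging over fold 0 has replaced `w₀ ⬝ z₂` by `g z₂`, which breaks the cycle: `z₁` now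
  -- averages out for fixed fold 2, and then `g z₂` is centred because `z₂` is.
  have hin : ∀ u₂ : (Fin K → ℝ) × (Fin K → ℝ),
      ∫ u₁, (u₂.1 ⬝ᵥ u₁.2 + g u₂.2) ∂ρ₁ = g u₂.2 := by
    intro u₂
    obtain ⟨h1, h2⟩ := hdot ρ₁ u₂.1 hi₁ hz₁
    rw [integral_add h1 (integrable_const _), h2]
    simp
  simp_rw [hin]
  have := (LinearMap.toContinuousLinearMap g).integral_comp_comm hi₂
  rw [hz₂, map_zero] at this
  exact this

end CyclicProduct

/-! ### Slutsky-type rules for convergence in measure. -/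

section InMeasure

variable {Ω : Type*} [MeasurableSpace Ω] {P : Measure Ω}

theorem tendstoInMeasure_comp_const {f g : ℕ → Ω → ℝ} {a b : ℝ} {φ : ℝ → ℝ → ℝ}
    (hf : TendstoInMeasure P f atTop (fun _ => a)) (hg : TendstoInMeasure P g atTop (fun _ => b))
    (hφ : ContinuousAt (fun p : ℝ × ℝ => φ p.1 p.2) (a, b)) :
    TendstoInMeasure P (fun n ω => φ (f n ω) (g n ω)) atTop (fun _ => φ a b) := by
  rw [tendstoInMeasure_iff_dist] at hf hg ⊢
  intro ε hε
  obtain ⟨δ, hδ, h⟩ := Metric.continuousAt_iff.1 hφ ε hε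
  refine tendsto_of_tendsto_of_tendsto_of_le_of_le tendsto_const_nhds
    (by simpa using (hf δ hδ).add (hg δ hδ)) (fun _ => zero_le) fun n => ?_
  refine (measure_mono fun ω hω => ?_).trans (measure_union_le _ _)
  by_contra hc
  simp only [Set.mem_union, Set.mem_ofPred_eq, not_or, not_le] at hc hω
  exact absurd (h (x := (f n ω, g n ω)) (by rw [Prod.dist_eq]; exact max_lt hc.1 hc.2))
    (not_lt.2 hω)

/-- If `X` tends to `0` in measure and `W` is bounded in probability then `X W` tends to `0`. -/
theorem tendstoInMeasure_mul_of_tight {X W : ℕ → Ω → ℝ} {C : ℝ}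
    (hX : TendstoInMeasure P X atTop (fun _ => 0))
    (hW : ∀ M : ℝ, 0 < M → ∀ n, P {ω | M ≤ |W n ω|} ≤ ENNReal.ofReal (C / M ^ 2)) :
    TendstoInMeasure P (fun n ω => X n ω * W n ω) atTop (fun _ => 0) := by
  rw [tendstoInMeasure_iff_norm] at hX ⊢
  simp only [sub_zero, Real.norm_eq_abs] at hX ⊢
  intro ε hε
  rw [ENNReal.tendsto_nhds_zero]
  intro η hη
  have hlim : Tendsto (fun M : ℝ => ENNReal.ofReal (C / M ^ 2)) atTop (nhds 0) := by
    have : Tendsto (fun M : ℝ => C / M ^ 2) atTop (nhds 0) :=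
      tendsto_const_nhds.div_atTop (tendsto_pow_atTop two_ne_zero)
    simpa using ENNReal.tendsto_ofReal this
  obtain ⟨M, hM, hM0⟩ := ((ENNReal.tendsto_nhds_zero.1 hlim (η / 2)
    (ENNReal.half_pos hη.ne')).and (eventually_gt_atTop 0)).exists
  filter_upwards [ENNReal.tendsto_nhds_zero.1 (hX (ε / M) (by positivity)) (η / 2)
    (ENNReal.half_pos hη.ne')] with n hn
  calc P {ω | ε ≤ |X n ω * W n ω|}
      ≤ P ({ω | ε / M ≤ |X n ω|} ∪ {ω | M ≤ |W n ω|}) := by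
        refine measure_mono fun ω hω => ?_
        by_contra hc
        simp only [Set.mem_union, Set.mem_ofPred_eq, not_or, not_le, abs_mul] at hc hω
        have h1 : |X n ω| * |W n ω| ≤ |X n ω| * M :=
          mul_le_mul_of_nonneg_left hc.2.le (abs_nonneg _)
        have h2 : |X n ω| * M < ε := (lt_div_iff₀ hM0).1 hc.1
        linarith
    _ ≤ η / 2 + η / 2 := (measure_union_le _ _).trans (add_le_add hn ((hW M hM0 n).trans hM))
    _ = η := ENNReal.add_halves η

theorem tendstoInMeasure_mul_of_ae_eq_zero {X W : ℕ → Ω → ℝ} (hW : ∀ n, W n =ᵐ[P] 0) :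
    TendstoInMeasure P (fun n ω => X n ω * W n ω) atTop (fun _ => 0) := by
  rw [tendstoInMeasure_iff_norm]
  intro ε hε
  refine tendsto_const_nhds.congr fun n => (measure_mono_null (fun ω hω => ?_) (hW n)).symm
  intro h
  have h0 : W n ω = 0 := h
  simp only [Set.mem_ofPred_eq, h0, mul_zero, sub_zero, norm_zero] at hω
  linarith

theorem tendstoInMeasure_finsetSum {ι : Type*} (s : Finset ι) {f : ι → ℕ → Ω → ℝ}
    (hf : ∀ i ∈ s, TendstoInMeasure P (f i) atTop (fun _ => 0)) :
    TendstoInMeasure P (fun n ω => ∑ i ∈ s, f i n ω) atTop (fun _ => 0) := by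
  classical
  induction s using Finset.induction_on with
  | empty =>
    rw [tendstoInMeasure_iff_norm]
    intro ε hε
    simp [not_le.2 hε]
  | insert i s hi ih =>
    simp_rw [Finset.sum_insert hi]
    have := tendstoInMeasure_comp_const (φ := fun x y => x + y)
      (hf i (Finset.mem_insert_self _ _)) (ih fun j hj => hf j (Finset.mem_insert_of_mem hj))
      (by fun_prop)
    simpa using this

end InMeasure

/-! ### Conditioning on an independent variable with finitely many values. -/

section RandomIndex

variable {Ω S D : Type*} [MeasurableSpace Ω] [Finite S] [MeasurableSpace S]
  [MeasurableSingletonClass S] [MeasurableSpace D] {P : Measure Ω} [IsProbabilityMeasure P]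
  {A : Ω → S} {B : Ω → D} {Q : Measure D}

theorem measurable_uncurry_of_finite {Φ : S → D → ℝ} (hΦ : ∀ s, Measurable (Φ s)) :
    Measurable (fun p : S × D => Φ p.1 p.2) :=
  measurable_from_prod_countable_right hΦ

/-- The joint law is a product, so Fubini's criterion applies; its second condition, on the norms as
a function of `s`, is automatic on a finite space. -/
theorem integrable_comp_iff_of_indepFun [SFinite Q] (hA : AEMeasurable A P) (hB : HasLaw B Q P)
    (hAB : IndepFun A B P) {Φ : S → D → ℝ} (hΦ : ∀ s, Measurable (Φ s)) :
    Integrable (fun ω => Φ (A ω) (B ω)) P ↔ ∀ᵐ s ∂(P.map A), Integrable (Φ s) Q := by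
  have hlaw := hAB.hasLaw_prod ⟨hA, rfl⟩ hB
  have := Measure.isProbabilityMeasure_map (μ := P) hA
  have hm := (measurable_uncurry_of_finite hΦ).aestronglyMeasurable (μ := (P.map A).prod Q)
  have h := integrable_map_measure (μ := P) (f := fun ω => (A ω, B ω))
    (g := fun p : S × D => Φ p.1 p.2) (by rw [hlaw.map_eq]; exact hm) hlaw.aemeasurable
  refine h.symm.trans ?_
  rw [hlaw.map_eq, integrable_prod_iff hm]
  exact and_iff_left .of_finite

theorem integral_comp_of_indepFun [SFinite Q] (hA : AEMeasurable A P) (hB : HasLaw B Q P)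
    (hAB : IndepFun A B P) {Φ : S → D → ℝ} (hΦ : ∀ s, Measurable (Φ s))
    (hint : Integrable (fun ω => Φ (A ω) (B ω)) P) :
    ∫ ω, Φ (A ω) (B ω) ∂P = ∫ s, ∫ x, Φ s x ∂Q ∂(P.map A) := by
  have hlaw := hAB.hasLaw_prod ⟨hA, rfl⟩ hB
  have := Measure.isProbabilityMeasure_map (μ := P) hA
  have hm := (measurable_uncurry_of_finite hΦ).aestronglyMeasurable (μ := (P.map A).prod Q)
  have h := integrable_map_measure (μ := P) (f := fun ω => (A ω, B ω))
    (g := fun p : S × D => Φ p.1 p.2) (by rw [hlaw.map_eq]; exact hm) hlaw.aemeasurable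
  rw [← integral_prod (fun p : S × D => Φ p.1 p.2) (by rw [← hlaw.map_eq]; exact h.2 hint),
    ← hlaw.map_eq, integral_map hlaw.aemeasurable (by rw [hlaw.map_eq]; exact hm)]

theorem lintegral_comp_of_indepFun [SFinite Q] (hA : AEMeasurable A P) (hB : HasLaw B Q P)
    (hAB : IndepFun A B P) {Φ : S → D → ℝ≥0∞} (hΦ : ∀ s, Measurable (Φ s)) :
    ∫⁻ ω, Φ (A ω) (B ω) ∂P = ∫⁻ s, ∫⁻ x, Φ s x ∂Q ∂(P.map A) := by
  have hlaw := hAB.hasLaw_prod ⟨hA, rfl⟩ hB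
  have hm : Measurable (fun p : S × D => Φ p.1 p.2) := measurable_from_prod_countable_right hΦ
  rw [← lintegral_prod (fun p : S × D => Φ p.1 p.2) hm.aemeasurable,
    ← hlaw.map_eq, lintegral_map' hm.aemeasurable hlaw.aemeasurable]

end RandomIndex

/-! ### Independence of functions of disjoint sets of coordinates. -/

section ProductMeasure

theorem indepFun_pi_of_dependsOn {O ι β γ : Type*} [MeasurableSpace O] [Fintype ι]
    [MeasurableSpace β] [MeasurableSpace γ] (L : Measure O) [IsProbabilityMeasure L]
    {S T : Finset ι} (hST : Disjoint S T) {F : (ι → O) → β} {G : (ι → O) → γ}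
    (hF : Measurable F) (hG : Measurable G) (hFS : DependsOn F S) (hGT : DependsOn G T) :
    IndepFun F G (Measure.pi fun _ : ι => L) := by
  classical
  obtain ⟨o⟩ : Nonempty O := nonempty_of_isProbabilityMeasure L
  -- Filling the missing coordinates with a fixed point `o` exhibits `F` and `G` as measurable
  -- functions of the restrictions to `S` and `T`.
  let e : ∀ R : Finset ι, (R → O) → ι → O := fun R x i => if h : i ∈ R then x ⟨i, h⟩ else o
  have he : ∀ R, Measurable (e R) := fun R => by
    refine measurable_pi_lambda _ fun i => ?_
    by_cases h : i ∈ R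
    · simpa only [e, h, dif_pos] using measurable_pi_apply _
    · simpa only [e, h, dif_neg, not_false_iff] using measurable_const
  have hid : iIndepFun (fun (i : ι) (x : ι → O) => x i) (Measure.pi fun _ : ι => L) :=
    iIndepFun_pi (X := fun _ => id) fun _ => aemeasurable_id
  have h := (hid.indepFun_finset S T hST fun i => measurable_pi_apply i).comp
    (hF.comp (he S)) (hG.comp (he T))
  convert h using 1
  · funext x
    exact hFS fun i hi => by simp [e, Finset.mem_coe.1 hi]
  · funext x
    exact hGT fun i hi => by simp [e, Finset.mem_coe.1 hi]

end ProductMeasure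

/-! ### Mean and integrability of the estimator for a deterministic split. -/

section FixedSplit

variable {K : ℕ} {d : Fin K → ℕ} {𝒳 : Type*} [MeasurableSpace 𝒳] {n : ℕ}

theorem measurable_avg (D : Finset (Fin n)) {f : Obs 𝒳 d → ℝ} (hf : Measurable f) :
    Measurable (fun x => avg D x f) := by
  unfold avg
  fun_prop

theorem integrable_avg (D : Finset (Fin n)) {L : Measure (Obs 𝒳 d)} [IsProbabilityMeasure L]
    {f : Obs 𝒳 d → ℝ} (hf : Integrable f L) :
    Integrable (fun x => avg D x f) (Measure.pi fun _ => L) :=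
  (integrable_finsetSum _ fun i _ =>
    (measurePreserving_eval (fun _ : Fin n => L) i).integrable_comp_of_integrable hf).const_mul _

theorem integral_avg (D : Finset (Fin n)) {L : Measure (Obs 𝒳 d)} [IsProbabilityMeasure L]
    {f : Obs 𝒳 d → ℝ} (hf : Integrable f L) :
    ∫ x, avg D x f ∂(Measure.pi fun _ => L) = (D.card : ℝ)⁻¹ * (D.card * ∫ o, f o ∂L) := by
  have hi : ∀ i : Fin n, ∫ x : Fin n → Obs 𝒳 d, f (x i) ∂(Measure.pi fun _ => L)
      = ∫ o, f o ∂L := by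
    intro i
    have hmp := measurePreserving_eval (fun _ : Fin n => L) i
    have := integral_map (f := f) hmp.measurable.aemeasurable
      (by rw [hmp.map_eq]; exact hf.aestronglyMeasurable)
    rw [hmp.map_eq] at this
    exact this.symm
  have hint : ∀ i ∈ D, Integrable (fun x : Fin n → Obs 𝒳 d => f (x i))
      (Measure.pi fun _ => L) := fun i _ =>
    (measurePreserving_eval (fun _ : Fin n => L) i).integrable_comp_of_integrable hf
  simp only [avg]
  rw [integral_const_mul, integral_finsetSum _ hint]
  simp [hi]

theorem disjoint_fold (s : Fin n → Fin 3) {i j : Fin 3} (hij : i ≠ j) :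
    Disjoint (fold s i) (fold s j) := by
  rw [Finset.disjoint_left]
  intro a ha hb
  simp only [fold, Finset.mem_filter_univ] at ha hb
  exact hij (ha.symm.trans hb)

variable (μ : ∀ k, Kernel 𝒳 (Fin (d k))) (π : Kernel 𝒳 (Slate d))

@[fun_prop]
theorem measurable_weight (s : Fin n → Fin 3) (j : Fin 3) (k : Fin K) :
    Measurable (fun x : Fin n → Obs 𝒳 d => weight μ π s x j k) :=
  (measurable_avg _ (by fun_prop)).div (measurable_avg _ (by fun_prop))

@[fun_prop]
theorem measurable_thetaHat (s : Fin n → Fin 3) :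
    Measurable (fun x : Fin n → Obs 𝒳 d => thetaHat μ π s x) := by
  refine (measurable_avg _ (by fun_prop)).sub (Finset.measurable_sum _ fun k _ =>
    Finset.measurable_sum _ fun j _ => ?_)
  exact ((measurable_weight μ π s _ k).const_mul _).mul (measurable_avg _ (by fun_prop))

/-- The share of fold `j` in the average of the control variate `k` over the whole sample. -/
noncomputable def foldMean (s : Fin n → Fin 3) (x : Fin n → Obs 𝒳 d) (j : Fin 3) (k : Fin K) : ℝ :=
  ((fold s j).card : ℝ) / n * avg (fold s j) x (fun o => Y μ π k o - 1)

@[fun_prop]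
theorem measurable_foldMean (s : Fin n → Fin 3) (j : Fin 3) (k : Fin K) :
    Measurable (fun x : Fin n → Obs 𝒳 d => foldMean μ π s x j k) :=
  (measurable_avg _ (by fun_prop)).const_mul _

theorem thetaHat_eq (s : Fin n → Fin 3) (x : Fin n → Obs 𝒳 d) :
    thetaHat μ π s x = avg Finset.univ x (GR μ π)
      - ∑ k, ∑ j, weight μ π s x (j + 1) k * foldMean μ π s x j k := by
  simp only [thetaHat, foldMean]
  congr 1
  refine Finset.sum_congr rfl fun k _ => Finset.sum_congr rfl fun j _ => by ring

/-- Weights and centred means computed on fold `j`. -/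
noncomputable def foldPair (s : Fin n → Fin 3) (j : Fin 3) (x : Fin n → Obs 𝒳 d) :
    (Fin K → ℝ) × (Fin K → ℝ) :=
  (fun k => weight μ π s x j k, fun k => foldMean μ π s x j k)

theorem measurable_foldPair (s : Fin n → Fin 3) (j : Fin 3) :
    Measurable (foldPair μ π s j : (Fin n → Obs 𝒳 d) → _) := by
  unfold foldPair
  fun_prop

theorem dependsOn_foldPair (s : Fin n → Fin 3) (j : Fin 3) :
    DependsOn (foldPair μ π s j : (Fin n → Obs 𝒳 d) → _) (fold s j : Set (Fin n)) := by
  intro x y hxy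
  have h : ∀ f : Obs 𝒳 d → ℝ, avg (fold s j) x f = avg (fold s j) y f := fun f => by
    simp only [avg]
    rw [Finset.sum_congr rfl fun i hi => by rw [hxy i hi]]
  simp only [foldPair, weight, foldMean, h]

variable {μ π} {L : Measure (Obs 𝒳 d)} [IsProbabilityMeasure L]

theorem integrable_foldMean (s : Fin n → Fin 3) (j : Fin 3) (k : Fin K)
    (hY : MemLp (Y μ π k) 2 L) :
    Integrable (fun x => foldMean μ π s x j k) (Measure.pi fun _ => L) :=
  (integrable_avg _ ((hY.integrable one_le_two).sub (integrable_const 1))).const_mul _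

theorem integral_foldMean (s : Fin n → Fin 3) (j : Fin 3) (k : Fin K)
    (hY : MemLp (Y μ π k) 2 L) (h0 : ∫ o, (Y μ π k o - 1) ∂L = 0) :
    ∫ x, foldMean μ π s x j k ∂(Measure.pi fun _ => L) = 0 := by
  unfold foldMean
  rw [integral_const_mul, integral_avg _ (f := fun o => Y μ π k o - 1) ((hY.integrable one_le_two).sub (integrable_const 1))]
  simp [h0]

theorem integral_sum_weight_mul_foldMean (s : Fin n → Fin 3) (hY : ∀ k, MemLp (Y μ π k) 2 L)
    (h0 : ∀ k, ∫ o, (Y μ π k o - 1) ∂L = 0)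
    (hint : Integrable (fun x => ∑ k, ∑ j, weight μ π s x (j + 1) k * foldMean μ π s x j k)
      (Measure.pi fun _ => L)) :
    ∫ x, (∑ k, ∑ j, weight μ π s x (j + 1) k * foldMean μ π s x j k) ∂(Measure.pi fun _ => L)
      = 0 := by
  set Q : Measure (Fin n → Obs 𝒳 d) := Measure.pi fun _ => L
  let U := foldPair (d := d) μ π s
  have hU : ∀ j, Measurable (U j) := measurable_foldPair μ π s
  have hdep : ∀ j, DependsOn (U j) (fold s j : Set (Fin n)) := dependsOn_foldPair μ π s
  have h12 : IndepFun (U 1) (U 2) Q :=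
    indepFun_pi_of_dependsOn L (disjoint_fold s (by decide)) (hU 1) (hU 2) (hdep 1) (hdep 2)
  have h012 : IndepFun (U 0) (fun x => (U 1 x, U 2 x)) Q := by
    classical
    refine indepFun_pi_of_dependsOn L (T := fold s 1 ∪ fold s 2)
      (Finset.disjoint_union_right.2 ⟨disjoint_fold s (by decide), disjoint_fold s (by decide)⟩)
      (hU 0) ((hU 1).prodMk (hU 2)) (hdep 0) ?_
    intro x y hxy
    exact Prod.ext (hdep 1 fun i hi => hxy i (by simp [Finset.mem_coe.1 hi]))
      (hdep 2 fun i hi => hxy i (by simp [Finset.mem_coe.1 hi]))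
  have hprob : ∀ j, IsProbabilityMeasure (Q.map (U j)) := fun j =>
    Measure.isProbabilityMeasure_map (hU j).aemeasurable
  have hmap : Q.map (fun x => (U 0 x, (U 1 x, U 2 x)))
      = (Q.map (U 0)).prod ((Q.map (U 1)).prod (Q.map (U 2))) := by
    rw [h012.map_prod_eq_prod_map_map (hU 0).aemeasurable
      ((hU 1).prodMk (hU 2)).aemeasurable,
      h12.map_prod_eq_prod_map_map (hU 1).aemeasurable (hU 2).aemeasurable]
  have hUi : ∀ j, Integrable (fun x => (U j x).2) Q := fun j =>
    Integrable.of_eval fun k => integrable_foldMean s j k (hY k)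
  have hi : ∀ j, Integrable (fun u => u.2) (Q.map (U j)) := fun j =>
    (integrable_map_measure measurable_snd.aestronglyMeasurable (hU j).aemeasurable).2 (hUi j)
  have hz : ∀ j, ∫ u, u.2 ∂(Q.map (U j)) = 0 := by
    intro j
    rw [integral_map (hU j).aemeasurable measurable_snd.aestronglyMeasurable]
    funext k
    refine (eval_integral fun k => integrable_foldMean s j k (hY k)) _ |>.trans ?_
    exact integral_foldMean s j k (hY k) (h0 k)
  let T : ((Fin K → ℝ) × (Fin K → ℝ)) ×
      (((Fin K → ℝ) × (Fin K → ℝ)) × ((Fin K → ℝ) × (Fin K → ℝ))) → ℝ := fun p =>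
    p.2.1.1 ⬝ᵥ p.1.2 + p.2.2.1 ⬝ᵥ p.2.1.2 + p.1.1 ⬝ᵥ p.2.2.2
  have hTm : Measurable T := by
    simp only [T, dotProduct]
    fun_prop
  have hTU : ∀ x, ∑ k, ∑ j, weight μ π s x (j + 1) k * foldMean μ π s x j k
      = T (U 0 x, (U 1 x, U 2 x)) := by
    intro x
    simp only [T, U, foldPair, dotProduct, Fin.sum_univ_three, Finset.sum_add_distrib]
    -- The shifts `0 + 1`, `1 + 1`, `2 + 1` reduce to `1`, `2`, `0` in `Fin 3`, which is the cyclic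
    -- pattern of `T`.
    rfl
  simp_rw [hTU] at hint ⊢
  have hV : Measurable fun x => (U 0 x, (U 1 x, U 2 x)) :=
    (hU 0).prodMk ((hU 1).prodMk (hU 2))
  rw [← integral_map (f := T) hV.aemeasurable hTm.aestronglyMeasurable, hmap]
  refine integral_cyclic_dotProduct_eq_zero _ _ _ (hi 0) (hi 1) (hi 2) (hz 0) (hz 1) (hz 2) ?_
  rw [← hmap]
  exact (integrable_map_measure hTm.aestronglyMeasurable hV.aemeasurable).2 hint

theorem integral_thetaHat_fixed (hn : 1 ≤ n) (s : Fin n → Fin 3) (hGR : MemLp (GR μ π) 2 L)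
    (hY : ∀ k, MemLp (Y μ π k) 2 L) (h0 : ∀ k, ∫ o, (Y μ π k o - 1) ∂L = 0)
    (hint : Integrable (thetaHat μ π s) (Measure.pi fun _ => L)) :
    ∫ x, thetaHat μ π s x ∂(Measure.pi fun _ => L) = theta μ π L := by
  have hG := integrable_avg (Finset.univ : Finset (Fin n)) (hGR.integrable one_le_two)
  -- Only the total correction is known to be integrable, as the difference of two integrable
  -- functions.
  have hT : Integrable (fun x => ∑ k, ∑ j, weight μ π s x (j + 1) k * foldMean μ π s x j k)
      (Measure.pi fun _ => L) := by
    refine (hG.sub hint).congr (ae_of_all _ fun x => ?_)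
    simp [thetaHat_eq]
  simp_rw [thetaHat_eq]
  rw [integral_sub hG hT, integral_sum_weight_mul_foldMean s hY h0 hT,
    integral_avg _ (hGR.integrable one_le_two)]
  have : (n : ℝ) ≠ 0 := by positivity
  simp [theta, this]

/-- Folds `j + 1` and `j` are disjoint, so each product has independent integrable factors. -/
theorem integrable_thetaHat_fixed (s : Fin n → Fin 3) (hGR : MemLp (GR μ π) 2 L)
    (hY : ∀ k, MemLp (Y μ π k) 2 L)
    (hw : ∀ j k, Integrable (fun x => weight μ π s x j k) (Measure.pi fun _ => L)) :
    Integrable (thetaHat μ π s) (Measure.pi fun _ => L) := by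
  have heq : thetaHat μ π s = fun x => avg Finset.univ x (GR μ π)
      - ∑ k, ∑ j, weight μ π s x (j + 1) k * foldMean μ π s x j k :=
    funext (thetaHat_eq μ π s)
  rw [heq]
  refine (integrable_avg _ (hGR.integrable one_le_two)).sub
    (integrable_finsetSum _ fun k _ => integrable_finsetSum _ fun j _ => ?_)
  have hind : IndepFun (foldPair μ π s (j + 1)) (foldPair μ π s j)
      (Measure.pi fun _ : Fin n => L) :=
    indepFun_pi_of_dependsOn L (disjoint_fold s (by revert j; decide))
      (measurable_foldPair μ π s _) (measurable_foldPair μ π s _)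
      (dependsOn_foldPair μ π s _) (dependsOn_foldPair μ π s _)
  have hind' : IndepFun (fun x => weight μ π s x (j + 1) k) (fun x => foldMean μ π s x j k)
      (Measure.pi fun _ : Fin n => L) :=
    hind.comp (φ := fun u : (Fin K → ℝ) × (Fin K → ℝ) => u.1 k)
      (ψ := fun u : (Fin K → ℝ) × (Fin K → ℝ) => u.2 k) (by fun_prop) (by fun_prop)
  exact hind'.integrable_mul (hw _ _) (integrable_foldMean s j k (hY k))

end FixedSplit

/-! ### Domination of the fitted weights. -/

section WeightBound

/-- Write `|a b| = |a / b| b²` and bound `b²` by the full sum of squares. Terms with `b = 0` vanish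
on both sides, which is how division by zero encodes the indicator of `Y_k ≠ 1`. -/
theorem abs_sum_mul_div_sum_sq_le {ι : Type*} (D : Finset ι) (a b : ι → ℝ) :
    |(∑ i ∈ D, a i * b i) / ∑ i ∈ D, b i ^ 2| ≤ ∑ i ∈ D, |a i / b i| := by
  have hB : 0 ≤ ∑ i ∈ D, b i ^ 2 := Finset.sum_nonneg fun i _ => sq_nonneg _
  rw [abs_div, abs_of_nonneg hB]
  refine div_le_of_le_mul₀ hB (Finset.sum_nonneg fun i _ => abs_nonneg _) ?_
  rw [Finset.sum_mul]
  refine (Finset.abs_sum_le_sum_abs _ _).trans (Finset.sum_le_sum fun i hi => ?_)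
  by_cases hb : b i = 0
  · simp [hb]
  · have h1 : |a i * b i| = |a i / b i| * b i ^ 2 := by
      rw [← sq_abs (b i), abs_mul, abs_div]
      have : |b i| ≠ 0 := abs_ne_zero.2 hb
      field_simp
    rw [h1]
    exact mul_le_mul_of_nonneg_left
      (Finset.single_le_sum (f := fun i => b i ^ 2) (fun i _ => sq_nonneg _) hi) (abs_nonneg _)

theorem abs_weight_le {K : ℕ} {d : Fin K → ℕ} {𝒳 : Type*} [MeasurableSpace 𝒳] {n : ℕ}
    (μ : ∀ k, Kernel 𝒳 (Fin (d k))) (π : Kernel 𝒳 (Slate d)) (s : Fin n → Fin 3)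
    (x : Fin n → Obs 𝒳 d) (j : Fin 3) (k : Fin K) :
    |weight μ π s x j k| ≤ ∑ i, |GR μ π (x i) / (Y μ π k (x i) - 1)| := by
  refine le_trans ?_ (Finset.sum_le_sum_of_subset_of_nonneg (Finset.subset_univ (fold s j))
    fun i _ _ => abs_nonneg _)
  by_cases hc : ((fold s j).card : ℝ) = 0
  · have : weight μ π s x j k = 0 := by simp [weight, avg, hc]
    rw [this, abs_zero]
    exact Finset.sum_nonneg fun i _ => abs_nonneg _
  · have : weight μ π s x j k = (∑ i ∈ fold s j, GR μ π (x i) * (Y μ π k (x i) - 1)) /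
        ∑ i ∈ fold s j, (Y μ π k (x i) - 1) ^ 2 := by
      simp only [weight, avg]
      exact mul_div_mul_left _ _ (inv_ne_zero hc)
    rw [this]
    exact abs_sum_mul_div_sum_sq_le _ _ _

end WeightBound

/-! ### Linearisation, law of large numbers on folds, and negligibility of the remainder. -/

section Asymptotics

variable {K : ℕ} {d : Fin K → ℕ} {𝒳 : Type*} [MeasurableSpace 𝒳]

theorem foldMean_eq {n : ℕ} (μ : ∀ k, Kernel 𝒳 (Fin (d k))) (π : Kernel 𝒳 (Slate d))
    (s : Fin n → Fin 3) (x : Fin n → Obs 𝒳 d) (j : Fin 3) (k : Fin K) :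
    foldMean μ π s x j k = (n : ℝ)⁻¹ * ∑ i ∈ fold s j, (Y μ π k (x i) - 1) := by
  unfold foldMean avg
  rcases (fold s j).eq_empty_or_nonempty with h | h
  · simp [h]
  · have : ((fold s j).card : ℝ) ≠ 0 := by exact_mod_cast h.card_pos.ne'
    field_simp

theorem sum_foldMean {n : ℕ} (μ : ∀ k, Kernel 𝒳 (Fin (d k))) (π : Kernel 𝒳 (Slate d))
    (s : Fin n → Fin 3) (x : Fin n → Obs 𝒳 d) (k : Fin K) :
    ∑ j, foldMean μ π s x j k = (n : ℝ)⁻¹ * ∑ i, (Y μ π k (x i) - 1) := by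
  simp_rw [foldMean_eq, ← Finset.mul_sum]
  congr 1
  exact Finset.sum_fiberwise _ s _

/-- The estimator differs from the sample mean of `Γ_w` by products of weight errors and fold
means. -/
theorem sqrt_mul_thetaHat_sub {n : ℕ} (μ : ∀ k, Kernel 𝒳 (Fin (d k))) (π : Kernel 𝒳 (Slate d))
    (w : Fin K → ℝ) (θ : ℝ) (s : Fin n → Fin 3) (x : Fin n → Obs 𝒳 d) :
    √(n : ℝ) * (thetaHat μ π s x - θ) - (√(n : ℝ))⁻¹ * (∑ i, Gam μ π w (x i) - n * θ)
      = ∑ k, ∑ j, (w k - weight μ π s x (j + 1) k) * (√(n : ℝ) * foldMean μ π s x j k) := by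
  rcases Nat.eq_zero_or_pos n with rfl | hn
  · simp
  have hs : √(n : ℝ) ≠ 0 := by positivity
  have hn0 : (n : ℝ) ≠ 0 := by positivity
  have hsq : (√(n : ℝ))⁻¹ = √(n : ℝ) * (n : ℝ)⁻¹ := by
    field_simp
    exact (Real.sq_sqrt (by positivity)).symm
  have h1 : ∑ k, ∑ j, (w k - weight μ π s x (j + 1) k) * (√(n : ℝ) * foldMean μ π s x j k)
      = √(n : ℝ) * (∑ k, w k * ((n : ℝ)⁻¹ * ∑ i, (Y μ π k (x i) - 1))
        - ∑ k, ∑ j, weight μ π s x (j + 1) k * foldMean μ π s x j k) := by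
    simp_rw [← sum_foldMean μ π s x]
    rw [← Finset.sum_sub_distrib, Finset.mul_sum]
    refine Finset.sum_congr rfl fun k _ => ?_
    rw [Finset.mul_sum, ← Finset.sum_sub_distrib, Finset.mul_sum]
    exact Finset.sum_congr rfl fun j _ => by ring
  have h2 : ∑ i, Gam μ π w (x i)
      = ∑ i, GR μ π (x i) - ∑ k, w k * ∑ i, (Y μ π k (x i) - 1) := by
    simp only [Gam]
    rw [Finset.sum_sub_distrib, Finset.sum_comm]
    simp only [Finset.mul_sum]
  have h3 : ∑ k, w k * ((n : ℝ)⁻¹ * ∑ i, (Y μ π k (x i) - 1))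
      = (n : ℝ)⁻¹ * ∑ k, w k * ∑ i, (Y μ π k (x i) - 1) := by
    rw [Finset.mul_sum]
    exact Finset.sum_congr rfl fun k _ => by ring
  rw [h1, h2, h3, hsq, thetaHat_eq]
  simp only [avg, Finset.card_univ, Fintype.card_fin]
  field_simp
  ring

theorem hasLaw_sample {Ω : Type*} [MeasurableSpace Ω] {P : Measure Ω} {obs : ℕ → Ω → Obs 𝒳 d}
    {L : Measure (Obs 𝒳 d)} [SigmaFinite L]
    (hlaw : ∀ i, HasLaw (obs i) L P) (hindep : iIndepFun obs P) (n : ℕ) :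
    HasLaw (fun ω (i : Fin n) => obs i ω) (Measure.pi fun _ : Fin n => L) P :=
  (hindep.precomp Fin.val_injective).hasLaw_pi fun i => hlaw i

/-- The law of large numbers is taken in `L¹` because the error is then a number depending only on
the sample size, hence a bound uniform over all folds of that size. -/
theorem tendsto_lintegral_avg {Ω : Type*} [MeasurableSpace Ω] {P : Measure Ω}
    [IsProbabilityMeasure P] {obs : ℕ → Ω → Obs 𝒳 d} {L : Measure (Obs 𝒳 d)} [SigmaFinite L]
    (hlaw : ∀ i, HasLaw (obs i) L P) (hindep : iIndepFun obs P)
    {f : Obs 𝒳 d → ℝ} (hf : Measurable f) (hfi : Integrable f L) :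
    Tendsto (fun m : ℕ => ∫⁻ x, ‖avg Finset.univ x f - ∫ o, f o ∂L‖ₑ
      ∂(Measure.pi fun _ : Fin m => L)) atTop (nhds 0) := by
  have hint : ∫ ω, f (obs 0 ω) ∂P = ∫ o, f o ∂L :=
    (hlaw 0).integral_comp hf.aestronglyMeasurable
  have hid : ∀ i, IdentDistrib (obs i) (obs 0) P P := fun i =>
    ⟨(hlaw i).aemeasurable, (hlaw 0).aemeasurable, by rw [(hlaw i).map_eq, (hlaw 0).map_eq]⟩
  have hfi0 : Integrable (fun ω => f (obs 0 ω)) P := by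
    have := (hlaw 0).map_eq ▸ hfi
    exact this.comp_aemeasurable (hlaw 0).aemeasurable
  have h := strong_law_Lp (μ := P) le_rfl ENNReal.one_ne_top (fun i ω => f (obs i ω))
    (memLp_one_iff_integrable.2 hfi0)
    (fun i j hij => (hindep.indepFun hij).comp hf hf) (fun i => (hid i).comp hf)
  refine h.congr fun m => ?_
  rw [eLpNorm_one_eq_lintegral_enorm, ← (hasLaw_sample hlaw hindep m).lintegral_comp
    (f := fun x => ‖avg Finset.univ x f - ∫ o, f o ∂L‖ₑ)
    ((measurable_avg _ hf).sub_const _).enorm.aemeasurable]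
  refine lintegral_congr fun ω => ?_
  simp only [hint, avg, Finset.card_univ, Fintype.card_fin, smul_eq_mul]
  rw [Finset.sum_range]

variable {L : Measure (Obs 𝒳 d)} [IsProbabilityMeasure L]

/-- Averages over a set of indices depend in law only on its size. -/
theorem lintegral_avg_eq {n : ℕ} (D : Finset (Fin n)) {f : Obs 𝒳 d → ℝ} (hf : Measurable f)
    (c : ℝ) :
    ∫⁻ x, ‖avg D x f - c‖ₑ ∂(Measure.pi fun _ : Fin n => L)
      = ∫⁻ x, ‖avg (Finset.univ : Finset (Fin D.card)) x f - c‖ₑ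
          ∂(Measure.pi fun _ : Fin D.card => L) := by
  let g : Fin D.card → Fin n := fun i => (D.equivFin.symm i : Fin n)
  have hg : Function.Injective g := Subtype.val_injective.comp D.equivFin.symm.injective
  have hid : iIndepFun (fun (i : Fin n) (x : Fin n → Obs 𝒳 d) => x i)
      (Measure.pi fun _ : Fin n => L) :=
    iIndepFun_pi (X := fun _ => id) fun _ => aemeasurable_id
  have hlaw : HasLaw (fun (x : Fin n → Obs 𝒳 d) i => x (g i))
      (Measure.pi fun _ : Fin D.card => L) (Measure.pi fun _ : Fin n => L) :=
    (hid.precomp hg).hasLaw_pi fun i => (measurePreserving_eval (fun _ : Fin n => L) (g i)).hasLaw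
  have havg : ∀ x : Fin n → Obs 𝒳 d,
      avg D x f = avg (Finset.univ : Finset (Fin D.card)) (fun i => x (g i)) f := by
    intro x
    simp only [avg, Finset.card_univ, Fintype.card_fin]
    congr 1
    rw [← Finset.sum_coe_sort]
    exact (D.equivFin.symm.sum_comp fun i : D => f (x i)).symm
  simp_rw [havg]
  exact hlaw.lintegral_comp (f := fun y => ‖avg Finset.univ y f - c‖ₑ)
    ((measurable_avg _ hf).sub_const c).enorm.aemeasurable

variable {Ω : Type*} [MeasurableSpace Ω] {P : Measure Ω} [IsProbabilityMeasure P]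
  {obs : ℕ → Ω → Obs 𝒳 d}

variable {split : ∀ n : ℕ, Ω → Fin n → Fin 3}

/-- Law of large numbers over one fold of a random even split. -/
theorem tendstoInMeasure_avg_fold (hlaw : ∀ i, HasLaw (obs i) L P) (hindep : iIndepFun obs P)
    (hsplit_meas : ∀ n, AEMeasurable (split n) P)
    (hsplit_even : ∀ n, ∀ᵐ ω ∂P, IsEvenSplit (split n ω))
    (hsplit_indep : ∀ n, IndepFun (split n) (fun ω (i : Fin n) => obs i ω) P)
    {f : Obs 𝒳 d → ℝ} (hf : Measurable f) (hfi : Integrable f L) (j : Fin 3) :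
    TendstoInMeasure P (fun n ω => avg (fold (split n ω) j) (fun i => obs i ω) f) atTop
      (fun _ => ∫ o, f o ∂L) := by
  have hdata := hasLaw_sample hlaw hindep
  refine tendstoInMeasure_of_tendsto_eLpNorm one_ne_zero (fun n => ?_)
    aestronglyMeasurable_const ?_
  · exact ((measurable_uncurry_of_finite (Φ := fun s x => avg (fold s j) x f)
      fun s => measurable_avg _ hf).comp_aemeasurable
        ((hsplit_meas n).prodMk (hdata n).aemeasurable)).aestronglyMeasurable
  rw [ENNReal.tendsto_nhds_zero]
  intro ε hε
  have hr := ENNReal.tendsto_nhds_zero.1 (tendsto_lintegral_avg hlaw hindep hf hfi) ε hε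
  obtain ⟨M, hM⟩ := eventually_atTop.1 hr
  -- For `n ≥ 3 * M` every fold of an even split has at least `n / 3 ≥ M` points.
  filter_upwards [eventually_ge_atTop (3 * M)] with n hn
  have := Measure.isProbabilityMeasure_map (μ := P) (hsplit_meas n)
  have heven : ∀ᵐ s ∂(P.map (split n)), IsEvenSplit s :=
    (ae_map_iff (hsplit_meas n) (Set.toFinite _).measurableSet).2 (hsplit_even n)
  rw [eLpNorm_one_eq_lintegral_enorm]
  refine (lintegral_comp_of_indepFun (hsplit_meas n) (hdata n) (hsplit_indep n)
    (Φ := fun s x => ‖avg (fold s j) x f - ∫ o, f o ∂L‖ₑ)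
    fun s => ((measurable_avg _ hf).sub_const _).enorm).trans_le ?_
  calc ∫⁻ s, ∫⁻ x, ‖avg (fold s j) x f - ∫ o, f o ∂L‖ₑ ∂(Measure.pi fun _ => L) ∂(P.map (split n))
      ≤ ∫⁻ _, ε ∂(P.map (split n)) := by
        refine lintegral_mono_ae (heven.mono fun s hs => ?_)
        rw [lintegral_avg_eq _ hf]
        exact hM _ (le_trans (by omega) (hs j).1)
    _ = ε := by simp

/-- Chebyshev: the scaled fold mean has variance `|D_j| / n` times that of `Y_k - 1`, and `|D_j| ≤
n`. The bound does not depend on the split. -/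
theorem measure_sqrt_mul_foldMean_le {n : ℕ} {μ : ∀ k, Kernel 𝒳 (Fin (d k))}
    {π : Kernel 𝒳 (Slate d)} {k : Fin K} (hY : MemLp (Y μ π k) 2 L)
    (h0 : ∫ o, (Y μ π k o - 1) ∂L = 0) (s : Fin n → Fin 3) (j : Fin 3) {M : ℝ} (hM : 0 < M) :
    (Measure.pi fun _ : Fin n => L) {x | M ≤ |√(n : ℝ) * foldMean μ π s x j k|}
      ≤ ENNReal.ofReal (Var[fun o => Y μ π k o - 1; L] / M ^ 2) := by
  set Q : Measure (Fin n → Obs 𝒳 d) := Measure.pi fun _ => L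
  have hZ : MemLp (fun o => Y μ π k o - 1) 2 L := hY.sub (memLp_const 1)
  have hmp := fun i : Fin n => measurePreserving_eval (fun _ : Fin n => L) i
  have hZi : ∀ i ∈ fold s j, MemLp (fun x : Fin n → Obs 𝒳 d => Y μ π k (x i) - 1) 2 Q :=
    fun i _ => hZ.comp_measurePreserving (hmp i)
  have heq : (fun x => √(n : ℝ) * foldMean μ π s x j k) = fun x => (√(n : ℝ) * (n : ℝ)⁻¹) *
      (∑ i ∈ fold s j, fun x : Fin n → Obs 𝒳 d => Y μ π k (x i) - 1) x := by
    funext x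
    rw [foldMean_eq, Finset.sum_apply, mul_assoc]
  have hmem : MemLp (fun x => √(n : ℝ) * foldMean μ π s x j k) 2 Q := by
    rw [heq]
    exact (memLp_finsetSum' _ hZi).const_mul _
  have hmean : ∫ x, √(n : ℝ) * foldMean μ π s x j k ∂Q = 0 := by
    rw [integral_const_mul, integral_foldMean s j k hY h0, mul_zero]
  have hvar : Var[fun x => √(n : ℝ) * foldMean μ π s x j k; Q]
      ≤ Var[fun o => Y μ π k o - 1; L] := by
    have hind : iIndepFun (fun (i : Fin n) (x : Fin n → Obs 𝒳 d) => Y μ π k (x i) - 1) Q :=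
      iIndepFun_pi (X := fun _ o => Y μ π k o - 1) fun _ => hZ.aestronglyMeasurable.aemeasurable
    have hvi : ∀ i : Fin n, Var[fun x : Fin n → Obs 𝒳 d => Y μ π k (x i) - 1; Q]
        = Var[fun o => Y μ π k o - 1; L] := fun i =>
      (hmp i).variance_fun_comp (f := fun o => Y μ π k o - 1) hZ.aestronglyMeasurable.aemeasurable
    rw [heq, variance_const_mul, IndepFun.variance_sum hZi fun i _ l _ hil => hind.indepFun hil]
    simp only [hvi, Finset.sum_const, nsmul_eq_mul]
    rw [mul_pow, Real.sq_sqrt (Nat.cast_nonneg n), ← mul_assoc]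
    refine mul_le_of_le_one_left (variance_nonneg _ _) ?_
    rcases Nat.eq_zero_or_pos n with rfl | hn
    · simp
    have hcard : ((fold s j).card : ℝ) ≤ n := by
      exact_mod_cast (Finset.card_le_univ _).trans_eq (Fintype.card_fin n)
    have hn' : (0 : ℝ) < n := by exact_mod_cast hn
    calc (n : ℝ) * (n : ℝ)⁻¹ ^ 2 * (fold s j).card = (fold s j).card / n := by field_simp
      _ ≤ 1 := (div_le_one hn').2 hcard
  have hcheb := meas_ge_le_variance_div_sq hmem hM
  rw [hmean] at hcheb
  simp only [sub_zero] at hcheb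
  exact hcheb.trans (ENNReal.ofReal_le_ofReal (by gcongr))

theorem measure_sqrt_mul_foldMean_split_le (hlaw : ∀ i, HasLaw (obs i) L P)
    (hindep : iIndepFun obs P) (hsplit_meas : ∀ n, AEMeasurable (split n) P)
    (hsplit_indep : ∀ n, IndepFun (split n) (fun ω (i : Fin n) => obs i ω) P)
    {μ : ∀ k, Kernel 𝒳 (Fin (d k))} {π : Kernel 𝒳 (Slate d)} {k : Fin K}
    (hY : MemLp (Y μ π k) 2 L) (h0 : ∫ o, (Y μ π k o - 1) ∂L = 0) (j : Fin 3) {M : ℝ}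
    (hM : 0 < M) (n : ℕ) :
    P {ω | M ≤ |√(n : ℝ) * foldMean μ π (split n ω) (fun i => obs i ω) j k|}
      ≤ ENNReal.ofReal (Var[fun o => Y μ π k o - 1; L] / M ^ 2) := by
  have hl := (hsplit_indep n).hasLaw_prod ⟨hsplit_meas n, rfl⟩ (hasLaw_sample hlaw hindep n)
  have := Measure.isProbabilityMeasure_map (μ := P) (hsplit_meas n)
  have hm : Measurable (fun p : (Fin n → Fin 3) × (Fin n → Obs 𝒳 d) =>
      |√(n : ℝ) * foldMean μ π p.1 p.2 j k|) := by
    refine measurable_uncurry_of_finite (Φ := fun s x => |√(n : ℝ) * foldMean μ π s x j k|)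
      fun s => ?_
    fun_prop
  have hset : MeasurableSet {p : (Fin n → Fin 3) × (Fin n → Obs 𝒳 d) |
      M ≤ |√(n : ℝ) * foldMean μ π p.1 p.2 j k|} := measurableSet_le measurable_const hm
  rw [hl.measure_eq (p := fun p => M ≤ |√(n : ℝ) * foldMean μ π p.1 p.2 j k|) hset,
    Measure.prod_apply hset]
  calc _ ≤ ∫⁻ _, ENNReal.ofReal (Var[fun o => Y μ π k o - 1; L] / M ^ 2) ∂(P.map (split n)) :=
        lintegral_mono fun s => measure_sqrt_mul_foldMean_le hY h0 s j hM
    _ = _ := by simp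

/-- Consistency times tightness suffices, so the folds `i` and `j` are arbitrary: disjointness
matters for the bias only. -/
theorem tendstoInMeasure_weight_error_mul (hlaw : ∀ i, HasLaw (obs i) L P)
    (hindep : iIndepFun obs P) (hsplit_meas : ∀ n, AEMeasurable (split n) P)
    (hsplit_even : ∀ n, ∀ᵐ ω ∂P, IsEvenSplit (split n ω))
    (hsplit_indep : ∀ n, IndepFun (split n) (fun ω (i : Fin n) => obs i ω) P)
    {μ : ∀ k, Kernel 𝒳 (Fin (d k))} {π : Kernel 𝒳 (Slate d)} {k : Fin K}
    (hGR : MemLp (GR μ π) 2 L) (hY : MemLp (Y μ π k) 2 L)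
    (h0 : ∫ o, (Y μ π k o - 1) ∂L = 0) (i j : Fin 3) :
    TendstoInMeasure P (fun n ω => (wStar μ π L k -
        weight μ π (split n ω) (fun i => obs i ω) i k) *
      (√(n : ℝ) * foldMean μ π (split n ω) (fun i => obs i ω) j k)) atTop (fun _ => 0) := by
  have hZ : MemLp (fun o => Y μ π k o - 1) 2 L := hY.sub (memLp_const 1)
  have hW := fun (M : ℝ) (hM : 0 < M) (n : ℕ) =>
    measure_sqrt_mul_foldMean_split_le hlaw hindep hsplit_meas hsplit_indep hY h0 j hM n
  have hvar : Var[fun o => Y μ π k o - 1; L] = ∫ o, (Y μ π k o - 1) ^ 2 ∂L :=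
    variance_of_integral_eq_zero hZ.aestronglyMeasurable.aemeasurable h0
  by_cases hb : ∫ o, (Y μ π k o - 1) ^ 2 ∂L = 0
  -- In a degenerate slot the quotient is not continuous at the limit, but the fold mean vanishes
  -- almost surely: Chebyshev with variance `0` is applied at each threshold `1 / (m + 1)`.
  · refine tendstoInMeasure_mul_of_ae_eq_zero fun n => ?_
    have hm : ∀ m : ℕ, ∀ᵐ ω ∂P, ¬ (1 / ((m : ℝ) + 1) ≤
        |√(n : ℝ) * foldMean μ π (split n ω) (fun i => obs i ω) j k|) := by
      intro m
      have := hW (1 / ((m : ℝ) + 1)) (by positivity) n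
      rw [hvar, hb, zero_div, ENNReal.ofReal_zero, nonpos_iff_eq_zero] at this
      rw [ae_iff]
      simpa using this
    filter_upwards [ae_all_iff.2 hm] with ω hω
    by_contra hne
    obtain ⟨m, hm⟩ := exists_nat_one_div_lt (abs_pos.2 hne)
    exact hω m hm.le
  · refine tendstoInMeasure_mul_of_tight ?_ hW
    have hnum := tendstoInMeasure_avg_fold hlaw hindep hsplit_meas hsplit_even hsplit_indep
      (f := fun o => GR μ π o * (Y μ π k o - 1)) (by fun_prop) (hGR.integrable_mul hZ) i
    have hden := tendstoInMeasure_avg_fold hlaw hindep hsplit_meas hsplit_even hsplit_indep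
      (f := fun o => (Y μ π k o - 1) ^ 2) (by fun_prop) hZ.integrable_sq i
    have := tendstoInMeasure_comp_const (φ := fun a b => wStar μ π L k - a / b) hnum hden
      (by fun_prop (disch := exact hb))
    simpa [wStar, weight] using this

end Asymptotics

end SlateOPE

/-! ### Passage from fixed to random splits, and the limit law. -/

open SlateOPE in
theorem lemma11 {K : ℕ} {d : Fin K → ℕ} {𝒳 : Type*} [MeasurableSpace 𝒳]
    -- context law, slot-level logging policies, reward kernel, target policy
    (ν : Measure 𝒳) [IsProbabilityMeasure ν]
    (μ : ∀ k, Kernel 𝒳 (Fin (d k))) [∀ k, IsMarkovKernel (μ k)]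
    (ρ : Kernel (𝒳 × Slate d) ℝ) [IsMarkovKernel ρ]
    (π : Kernel 𝒳 (Slate d)) [IsMarkovKernel π]
    -- the logging policy covers, slot by slot, the actions of the target policy
    (hcover : ∀ᵐ x ∂ν, ∀ k a, μ k x {a} = 0 → slotProb π k x a = 0)
    -- finite second moments
    (hGR : MemLp (GR μ π) 2 (dataLaw ν μ ρ))
    (hY : ∀ k, MemLp (Y μ π k) 2 (dataLaw ν μ ρ))
    -- i.i.d. observations
    {Ω : Type*} [MeasurableSpace Ω] (P : Measure Ω) [IsProbabilityMeasure P]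
    (obs : ℕ → Ω → Obs 𝒳 d)
    (hlaw : ∀ i, HasLaw (obs i) (dataLaw ν μ ρ) P)
    (hindep : iIndepFun obs P)
    -- for every `n`, a random even split of the first `n` observations, independent of them
    (split : ∀ n : ℕ, Ω → Fin n → Fin 3)
    (hsplit_meas : ∀ n, AEMeasurable (split n) P)
    (hsplit_even : ∀ n, ∀ᵐ ω ∂P, IsEvenSplit (split n ω))
    (hsplit_indep : ∀ n, IndepFun (split n) (fun ω (i : Fin n) => obs i ω) P) :
    -- unbiasedness for every `n ≥ 1` for which the estimator has an expectation
    (∀ n : ℕ, 1 ≤ n →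
      Integrable (fun ω => thetaHat μ π (split n ω) (fun i => obs i ω)) P →
      ∫ ω, thetaHat μ π (split n ω) (fun i => obs i ω) ∂P = theta μ π (dataLaw ν μ ρ)) ∧
    -- the expectation exists if the fitted weights have expectations
    (∀ n : ℕ, 1 ≤ n →
      (∀ j k, Integrable (fun ω => weight μ π (split n ω) (fun i => obs i ω) j k) P) →
      Integrable (fun ω => thetaHat μ π (split n ω) (fun i => obs i ω)) P) ∧
    -- the weights have expectations, for every `n`, if `E[|GR| / |Y_k - 1| ; Y_k ≠ 1] < ∞`
    ((∀ k, Integrable (fun o => GR μ π o / (Y μ π k o - 1)) (dataLaw ν μ ρ)) →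
      ∀ (n : ℕ) (j : Fin 3) (k : Fin K),
        Integrable (fun ω => weight μ π (split n ω) (fun i => obs i ω) j k) P) ∧
    -- asymptotic normality
    TendstoInDistribution
      (fun (n : ℕ) ω => √(n : ℝ) *
        (thetaHat μ π (split n ω) (fun i => obs i ω) - theta μ π (dataLaw ν μ ρ)))
      atTop id (fun _ => P) (gaussianReal 0 (Vstar μ π (dataLaw ν μ ρ)).toNNReal) := by
  have h0 : ∀ k, ∫ o, (Y μ π k o - 1) ∂(dataLaw ν μ ρ) = 0 := fun k =>
    integral_Y_sub_one ν μ ρ π hcover k (hY k)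
  have hdata := hasLaw_sample hlaw hindep
  refine ⟨fun n hn hint => ?_, fun n _ hw => ?_, fun hratio n j k => ?_, ?_⟩
  -- Integrability descends to almost every value of the split, where the fixed-split identity gives
  -- the constant `θ`.
  · have hfix := (integrable_comp_iff_of_indepFun (hsplit_meas n) (hdata n) (hsplit_indep n)
      (Φ := thetaHat μ π) (measurable_thetaHat μ π)).1 hint
    have := Measure.isProbabilityMeasure_map (μ := P) (hsplit_meas n)
    rw [integral_comp_of_indepFun (hsplit_meas n) (hdata n) (hsplit_indep n)
      (Φ := thetaHat μ π) (measurable_thetaHat μ π) hint,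
      integral_congr_ae (g := fun _ => theta μ π (dataLaw ν μ ρ))
        (hfix.mono fun s hs => integral_thetaHat_fixed hn s hGR hY h0 hs)]
    simp
  · refine (integrable_comp_iff_of_indepFun (hsplit_meas n) (hdata n) (hsplit_indep n)
      (Φ := thetaHat μ π) (measurable_thetaHat μ π)).2 ?_
    have hfix : ∀ j k, ∀ᵐ s ∂(P.map (split n)),
        Integrable (fun x => weight μ π s x j k) (Measure.pi fun _ => dataLaw ν μ ρ) :=
      fun j k => (integrable_comp_iff_of_indepFun (hsplit_meas n) (hdata n) (hsplit_indep n)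
        (Φ := fun s x => weight μ π s x j k) fun s => measurable_weight μ π s j k).1 (hw j k)
    filter_upwards [ae_all_iff.2 fun j => ae_all_iff.2 fun k => hfix j k] with s hs
    exact integrable_thetaHat_fixed s hGR hY hs
  · have hdom : Integrable (fun ω => ∑ i : Fin n,
        |GR μ π (obs i ω) / (Y μ π k (obs i ω) - 1)|) P := by
      refine integrable_finsetSum _ fun i _ => Integrable.abs ?_
      have := (hlaw i).map_eq ▸ hratio k
      exact this.comp_aemeasurable (hlaw i).aemeasurable
    refine hdom.mono' ?_ (ae_of_all _ fun ω => abs_weight_le μ π _ _ j k)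
    exact ((measurable_uncurry_of_finite (Φ := fun s x => weight μ π s x j k)
      fun s => measurable_weight μ π s j k).comp_aemeasurable
        ((hsplit_meas n).prodMk (hdata n).aemeasurable)).aestronglyMeasurable
  · set L := dataLaw ν μ ρ
    set w := wStar μ π L
    have hG : Measurable (Gam μ π w) := measurable_Gam μ π w
    have hmean : ∫ ω, Gam μ π w (obs 0 ω) ∂P = theta μ π L :=
      ((hlaw 0).integral_comp hG.aestronglyMeasurable).trans (integral_Gam hcover hGR hY w)
    have hvar : Var[fun ω => Gam μ π w (obs 0 ω); P] = Vstar μ π L := by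
      refine Eq.trans ?_ (Vstar_eq_variance hcover hGR hY).symm
      have := variance_map (X := Gam μ π w) hG.aemeasurable (hlaw 0).aemeasurable
      rw [(hlaw 0).map_eq] at this
      exact this.symm
    have hmem : MemLp (fun ω => Gam μ π w (obs 0 ω)) 2 P := by
      have hGam : MemLp (Gam μ π w) 2 L := memLp_Gam hGR hY w
      rw [← (hlaw 0).map_eq] at hGam
      exact hGam.comp_of_map (hlaw 0).aemeasurable
    have hid : ∀ i, IdentDistrib (obs i) (obs 0) P P := fun i =>
      ⟨(hlaw i).aemeasurable, (hlaw 0).aemeasurable, by rw [(hlaw i).map_eq, (hlaw 0).map_eq]⟩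
    have hclt := tendstoInDistribution_inv_sqrt_mul_sum_sub (P := P)
      (X := fun i ω => Gam μ π w (obs i ω)) (Y := id)
      (P' := gaussianReal 0 (Vstar μ π L).toNNReal) (by rw [hvar]; exact HasLaw.id) hmem
      (hindep.comp (fun _ => Gam μ π w) fun _ => hG) (fun i => (hid i).comp hG)
    -- Slutsky: it remains to show that the difference from the normalised sum of `Γ_{w*}` tends to
    -- `0` in measure.
    refine tendstoInDistribution_of_tendstoInMeasure_sub _ _ hclt ?_ fun n => ?_
    · refine (tendstoInMeasure_finsetSum Finset.univ fun k _ =>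
        tendstoInMeasure_finsetSum Finset.univ fun j _ =>
          tendstoInMeasure_weight_error_mul hlaw hindep hsplit_meas hsplit_even hsplit_indep
            hGR (hY k) (h0 k) (j + 1) j).congr_left fun n => ae_of_all _ fun ω => ?_
      refine (sqrt_mul_thetaHat_sub μ π w (theta μ π L) (split n ω) (fun i => obs i ω)).symm.trans ?_
      simp only [Pi.sub_apply, hmean]
      rw [Finset.sum_range]
    · exact (((measurable_uncurry_of_finite (Φ := thetaHat μ π)
        (measurable_thetaHat μ π)).comp_aemeasurable
          ((hsplit_meas n).prodMk (hdata n).aemeasurable)).sub_const _).const_mul _
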